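/- Let $\mathbf{U}=\{z\in\mathbf{C}:|z|<1\}$ and let $f:\mathbf{U}\to\mathbf{C}$ be analytic. Call $f$ a Bloch function if $(1-|z|^2)|f'(z)|$ is bounded in $z\in\mathbf{U}$. Call $f$ a normal function if the family $\{f\circ\varphi\}$, where $\varphi$ runs over all conformal automorphisms of $\mathbf{U}$ (holomorphic bijections $\mathbf{U}\to\mathbf{U}$), is a normal family, that is, every sequence in it has a subsequence that converges, uniformly on compact subsets of $\mathbf{U}$ with respect to the chordal distance on the Riemann sphere $\mathbf{C}\cup\{\infty\}$, to some function $\mathbf{U}\to\mathbf{C}\cup\{\infty\}$. Here the chordal distance is $\frac{|a-b|}{\sqrt{1+|a|^2}\sqrt{1+|b|^2}}$ for $a,b\in\mathbf{C}$, and $\frac{1}{\sqrt{1+|a|^2}}$ between $a\in\mathbf{C}$ and $\infty$. Then: (1) $f$ is a Bloch function if and only if $$\sqrt{1-|z|^2}\,\sqrt{1-|w|^2}\;\frac{|f(z)-f(w)|}{|z-w|}$$ is bounded as a function of $z,w\in\mathbf{U}$, $z\ne w$. (2) $f$ is a normal function if and only if $$\frac{\sqrt{1-|z|^2}\,\sqrt{1-|w|^2}}{\sqrt{1+|f(z)|^2}\,\sqrt{1+|f(w)|^2}}\;\frac{|f(z)-f(w)|}{|z-w|}$$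 is bounded as a function of $z,w\in\mathbf{U}$, $z\ne w$. -/

import Mathlib

open Set Filter Metric

noncomputable section

/-- The open unit disc in `ℂ`. -/
def unitDisc : Set ℂ := ball (0 : ℂ) 1

/-- `f` is a Bloch function in the unit disc: `(1 - |z|²) |f'(z)|` is bounded there. -/
def IsBlochFunction (f : ℂ → ℂ) : Prop :=
  ∃ C : ℝ, ∀ z ∈ unitDisc, (1 - ‖z‖ ^ 2) * ‖deriv f z‖ ≤ C

/-- The chordal (spherical) distance on the Riemann sphere `ℂ ∪ {∞}`. -/
def chordalDist : OnePoint ℂ → OnePoint ℂ → ℝ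
  | some z, some w => ‖z - w‖ / (√(1 + ‖z‖ ^ 2) * √(1 + ‖w‖ ^ 2))
  | some z, none => 1 / √(1 + ‖z‖ ^ 2)
  | none, some w => 1 / √(1 + ‖w‖ ^ 2)
  | none, none => 0

/-- The functions `u n` converge to `g` uniformly on compact subsets of `U` with respect to the
chordal distance. -/
def TendstoChordallyOn (u : ℕ → ℂ → OnePoint ℂ) (g : ℂ → OnePoint ℂ) (U : Set ℂ) : Prop :=
  ∀ K ⊆ U, IsCompact K → ∀ ε : ℝ, 0 < ε → ∀ᶠ n in atTop, ∀ z ∈ K, chordalDist (u n z) (g z) < ε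

/-- A family of sphere-valued functions is normal in `U` (in the sense of Montel): every sequence
in it has a subsequence that converges uniformly on compact subsets of `U` with respect to the
chordal distance. -/
def IsNormalFamilyOn (F : Set (ℂ → OnePoint ℂ)) (U : Set ℂ) : Prop :=
  ∀ u : ℕ → ℂ → OnePoint ℂ, (∀ n, u n ∈ F) →
    ∃ (k : ℕ → ℕ) (g : ℂ → OnePoint ℂ), StrictMono k ∧ TendstoChordallyOn (fun n => u (k n)) g U

/-- `φ` restricts to a conformal automorphism of the unit disc. -/
def IsDiscAutomorphism (φ : ℂ → ℂ) : Prop :=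
  DifferentiableOn ℂ φ unitDisc ∧ BijOn φ unitDisc unitDisc

/-- `f` is a normal function in the unit disc (Lehto and Virtanen): the compositions of `f` with
all conformal automorphisms of the disc form a normal family. -/
def IsNormalFunction (f : ℂ → ℂ) : Prop :=
  IsNormalFamilyOn
    {h | ∃ φ : ℂ → ℂ, IsDiscAutomorphism φ ∧ h = fun z => (f (φ z) : OnePoint ℂ)} unitDisc

end

/-! Both quotients are a distance between `f z` and `f w`, Euclidean or chordal, divided by
`sinhHalfDist z w` = sinh(d/2), with d the hyperbolic distance. A bound on the derivative of `f`
from the hyperbolic metric to the target metric integrates to distance ≤ C · d/2 ≤ C sinh(d/2)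
(`norm_sub_le_mul_sinhHalfDist`). For (1), letting `w` tend to `z` gives the converse.

For (2), the sphere is embedded in a Euclidean space where chordal distance is a norm. Normality
forces equicontinuity at `0` of all `f ∘ φ`, hence a Cauchy-type bound on their spherical
derivatives at `0`; moving `0` to `z` bounds (1 - |z|²)|f'|/(1 + |f|²) on the disc, which integrates
as before. Conversely, a bounded quotient gives all `f ∘ φ` one modulus of continuity, by
Schwarz–Pick, and Arzelà–Ascoli applies. -/

open scoped Topology ComplexConjugate

/-! ### Disc automorphisms and the Schwarz–Pick lemma -/

theorem mem_unitDisc {z : ℂ} : z ∈ unitDisc ↔ ‖z‖ < 1 := mem_ball_zero_iff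

theorem isOpen_unitDisc : IsOpen unitDisc := isOpen_ball

theorem one_sub_norm_sq_pos {z : ℂ} (hz : z ∈ unitDisc) : 0 < 1 - ‖z‖ ^ 2 := by
  have := mem_unitDisc.1 hz
  nlinarith [norm_nonneg z]

/-- The conformal automorphism of the unit disc that maps `0` to `a`. -/
noncomputable def discShift (a z : ℂ) : ℂ := (z + a) / (1 + conj a * z)

/-- The hyperbolic sine of half the hyperbolic distance of the unit disc. -/
noncomputable def sinhHalfDist (z w : ℂ) : ℝ :=
  ‖z - w‖ / (√(1 - ‖z‖ ^ 2) * √(1 - ‖w‖ ^ 2))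

theorem one_add_conj_mul_ne_zero {a z : ℂ} (ha : a ∈ unitDisc) (hz : z ∈ unitDisc) :
    1 + conj a * z ≠ 0 := by
  intro h
  have h1 : ‖conj a * z‖ = 1 := by
    rw [eq_neg_of_add_eq_zero_right h, norm_neg, norm_one]
  rw [norm_mul, Complex.norm_conj] at h1
  nlinarith [norm_nonneg z, norm_nonneg a, mem_unitDisc.1 ha, mem_unitDisc.1 hz]

theorem norm_one_add_conj_mul_sq_sub (a z : ℂ) :
    ‖1 + conj a * z‖ ^ 2 - ‖z + a‖ ^ 2 = (1 - ‖a‖ ^ 2) * (1 - ‖z‖ ^ 2) := by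
  simp only [Complex.sq_norm, Complex.normSq_apply, Complex.add_re, Complex.add_im,
    Complex.mul_re, Complex.mul_im, Complex.conj_re, Complex.conj_im, Complex.one_re,
    Complex.one_im]
  ring

theorem one_sub_norm_discShift_sq {a z : ℂ} (ha : a ∈ unitDisc) (hz : z ∈ unitDisc) :
    1 - ‖discShift a z‖ ^ 2 = (1 - ‖a‖ ^ 2) * (1 - ‖z‖ ^ 2) / ‖1 + conj a * z‖ ^ 2 := by
  have h : ‖1 + conj a * z‖ ≠ 0 := norm_ne_zero_iff.2 (one_add_conj_mul_ne_zero ha hz)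
  rw [discShift, norm_div, ← norm_one_add_conj_mul_sq_sub, div_pow, sub_div,
    div_self (pow_ne_zero 2 h)]

theorem discShift_mem {a z : ℂ} (ha : a ∈ unitDisc) (hz : z ∈ unitDisc) :
    discShift a z ∈ unitDisc := by
  have h : 0 < ‖1 + conj a * z‖ := norm_pos_iff.2 (one_add_conj_mul_ne_zero ha hz)
  have h1 : 0 < 1 - ‖discShift a z‖ ^ 2 := by
    rw [one_sub_norm_discShift_sq ha hz]
    have := one_sub_norm_sq_pos ha
    have := one_sub_norm_sq_pos hz
    positivity
  rw [mem_unitDisc]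
  nlinarith [norm_nonneg (discShift a z)]

theorem neg_mem_unitDisc {a : ℂ} (ha : a ∈ unitDisc) : -a ∈ unitDisc := by
  simpa [mem_unitDisc] using ha

theorem zero_mem_unitDisc : (0 : ℂ) ∈ unitDisc := by simp [mem_unitDisc]

@[simp] theorem discShift_zero (a : ℂ) : discShift a 0 = a := by simp [discShift]

@[simp] theorem discShift_neg_self (a : ℂ) : discShift (-a) a = 0 := by simp [discShift]

theorem discShift_discShift_neg {a z : ℂ} (ha : a ∈ unitDisc) (hz : z ∈ unitDisc) :
    discShift a (discShift (-a) z) = z := by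
  have h1 := one_add_conj_mul_ne_zero (neg_mem_unitDisc ha) hz
  have h2 := one_add_conj_mul_ne_zero ha (discShift_mem (neg_mem_unitDisc ha) hz)
  rw [discShift, div_eq_iff h2]
  have h3 : 1 - z * conj a ≠ 0 := by
    convert h1 using 1
    rw [map_neg]
    ring
  simp only [discShift, map_neg]
  rw [show 1 + -conj a * z = 1 - z * conj a by ring]
  field_simp
  ring

theorem discShift_neg_discShift {a z : ℂ} (ha : a ∈ unitDisc) (hz : z ∈ unitDisc) :
    discShift (-a) (discShift a z) = z := by
  simpa using discShift_discShift_neg (neg_mem_unitDisc ha) hz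

theorem hasDerivAt_discShift {a z : ℂ} (ha : a ∈ unitDisc) (hz : z ∈ unitDisc) :
    HasDerivAt (discShift a) ((1 - conj a * a) / (1 + conj a * z) ^ 2) z := by
  have h := one_add_conj_mul_ne_zero ha hz
  have h1 : HasDerivAt (fun z : ℂ => z + a) 1 z := (hasDerivAt_id z).add_const a
  have h2 : HasDerivAt (fun z : ℂ => 1 + conj a * z) (conj a) z := by
    simpa using ((hasDerivAt_id z).const_mul (conj a)).const_add 1
  refine (h1.div h2 h).congr_deriv ?_
  ring

theorem norm_one_sub_conj_mul_self {a : ℂ} (ha : a ∈ unitDisc) :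
    ‖1 - conj a * a‖ = 1 - ‖a‖ ^ 2 := by
  rw [Complex.conj_mul']
  have : (1 : ℂ) - (‖a‖ : ℂ) ^ 2 = ((1 - ‖a‖ ^ 2 : ℝ) : ℂ) := by push_cast; rfl
  rw [this, Complex.norm_real, Real.norm_of_nonneg (one_sub_norm_sq_pos ha).le]

theorem norm_deriv_discShift_mul {a z : ℂ} (ha : a ∈ unitDisc) (hz : z ∈ unitDisc) :
    ‖deriv (discShift a) z‖ * (1 - ‖z‖ ^ 2) = 1 - ‖discShift a z‖ ^ 2 := by
  rw [(hasDerivAt_discShift ha hz).deriv, one_sub_norm_discShift_sq ha hz, norm_div, norm_pow,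
    norm_one_sub_conj_mul_self ha]
  ring

theorem isDiscAutomorphism_discShift {a : ℂ} (ha : a ∈ unitDisc) :
    IsDiscAutomorphism (discShift a) :=
  ⟨fun _ hz => (hasDerivAt_discShift ha hz).differentiableAt.differentiableWithinAt,
    InvOn.bijOn (f' := discShift (-a))
      ⟨fun _ hz => discShift_neg_discShift ha hz, fun _ hz => discShift_discShift_neg ha hz⟩
      (fun _ hz => discShift_mem ha hz) fun _ hz => discShift_mem (neg_mem_unitDisc ha) hz⟩

theorem sinhHalfDist_eq_discShift {z w : ℂ} (hz : z ∈ unitDisc) (hw : w ∈ unitDisc) :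
    sinhHalfDist z w = ‖discShift (-z) w‖ / √(1 - ‖discShift (-z) w‖ ^ 2) := by
  have h := norm_pos_iff.2 (one_add_conj_mul_ne_zero (neg_mem_unitDisc hz) hw)
  rw [one_sub_norm_discShift_sq (neg_mem_unitDisc hz) hw, sinhHalfDist, norm_neg,
    Real.sqrt_div' _ (by positivity), Real.sqrt_sq h.le,
    Real.sqrt_mul (one_sub_norm_sq_pos hz).le, discShift, norm_div, ← sub_eq_add_neg,
    norm_sub_rev w z, div_div_div_cancel_right₀ h.ne']

theorem sinhHalfDist_pos {z w : ℂ} (hz : z ∈ unitDisc) (hw : w ∈ unitDisc) (h : z ≠ w) :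
    0 < sinhHalfDist z w :=
  div_pos (norm_pos_iff.2 (sub_ne_zero.2 h)) (mul_pos (Real.sqrt_pos.2 (one_sub_norm_sq_pos hz))
    (Real.sqrt_pos.2 (one_sub_norm_sq_pos hw)))

/-- The **Schwarz–Pick lemma**. -/
theorem sinhHalfDist_map_le {φ : ℂ → ℂ} (hd : DifferentiableOn ℂ φ unitDisc)
    (hm : MapsTo φ unitDisc unitDisc) {z w : ℂ} (hz : z ∈ unitDisc) (hw : w ∈ unitDisc) :
    sinhHalfDist (φ z) (φ w) ≤ sinhHalfDist z w := by
  have hζ := discShift_mem (neg_mem_unitDisc hz) hw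
  have hshift : ∀ a ∈ unitDisc, DifferentiableOn ℂ (discShift a) unitDisc :=
    fun a ha => (isDiscAutomorphism_discShift ha).1
  have hmap : ∀ a ∈ unitDisc, MapsTo (discShift a) unitDisc unitDisc :=
    fun a ha _ h => discShift_mem ha h
  have hza := neg_mem_unitDisc (hm hz)
  have key : ‖discShift (-φ z) (φ w)‖ ≤ ‖discShift (-z) w‖ := by
    -- Conjugating by shifts gives a self-map of the disc fixing `0`, so the Schwarz lemma applies.
    have := Complex.norm_le_norm_of_mapsTo_ball (R := 1)
      (f := fun ζ => discShift (-φ z) (φ (discShift z ζ)))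
      ((hshift _ hza).comp (hd.comp (hshift _ hz) (hmap _ hz)) (hm.comp (hmap _ hz)))
      (((hmap _ hza).comp (hm.comp (hmap _ hz))).mono_right ball_subset_closedBall)
      (by simp) (mem_unitDisc.1 hζ)
    simpa [discShift_discShift_neg hz hw] using this
  rw [sinhHalfDist_eq_discShift hz hw, sinhHalfDist_eq_discShift (hm hz) (hm hw)]
  have := Real.sqrt_pos.2 (one_sub_norm_sq_pos hζ)
  gcongr

/-! ### Growth under a hyperbolic derivative bound -/

theorem norm_fderiv_real_eq_norm_deriv {f : ℂ → ℂ} {z : ℂ} (h : DifferentiableAt ℂ f z) :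
    ‖fderiv ℝ f z‖ = ‖deriv f z‖ := by
  rw [h.fderiv_restrictScalars ℝ, ContinuousLinearMap.norm_restrictScalars,
    norm_deriv_eq_norm_fderiv]

section Growth

variable {E : Type*} [NormedAddCommGroup E] [NormedSpace ℝ E]

theorem hasDerivAt_div_sqrt_one_sub_sq {r t : ℝ} (h : 0 < 1 - (t * r) ^ 2) :
    HasDerivAt (fun t => t * r / √(1 - (t * r) ^ 2)) (r / (√(1 - (t * r) ^ 2)) ^ 3) t := by
  have h1 : HasDerivAt (fun t : ℝ => t * r) r t := by
    simpa using (hasDerivAt_id t).mul_const r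
  have h2 : HasDerivAt (fun t : ℝ => √(1 - (t * r) ^ 2))
      (-(2 * (t * r) * r) / (2 * √(1 - (t * r) ^ 2))) t := by
    simpa using ((h1.pow 2).const_sub 1).sqrt h.ne'
  have hs := Real.sqrt_pos.2 h
  refine (h1.div h2 hs.ne').congr_deriv ?_
  have hsq := Real.sq_sqrt h.le
  set s := √(1 - (t * r) ^ 2)
  field_simp
  linear_combination r * hsq

/-- Integration along the radius would give C artanh |z|; the bound is the larger C sinh(artanh
|z|). Derivatives are real because `stereo` is not holomorphic. -/
theorem norm_sub_zero_le_of_norm_fderiv_le {F : ℂ → E} {C : ℝ}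
    (hF : ∀ z ∈ unitDisc, DifferentiableAt ℝ F z)
    (hC : ∀ z ∈ unitDisc, ‖fderiv ℝ F z‖ * (1 - ‖z‖ ^ 2) ≤ C) {z : ℂ} (hz : z ∈ unitDisc) :
    ‖F z - F 0‖ ≤ C * (‖z‖ / √(1 - ‖z‖ ^ 2)) := by
  have hC0 : 0 ≤ C := by
    have := hC 0 zero_mem_unitDisc
    simp only [norm_zero] at this
    nlinarith [norm_nonneg (fderiv ℝ F 0)]
  have hmem : ∀ t ∈ Icc (0 : ℝ) 1, t • z ∈ unitDisc := by
    intro t ht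
    rw [mem_unitDisc, norm_smul, Real.norm_of_nonneg ht.1]
    exact (mul_le_of_le_one_left (norm_nonneg z) ht.2).trans_lt (mem_unitDisc.1 hz)
  have hnorm : ∀ t ∈ Icc (0 : ℝ) 1, ‖t • z‖ = t * ‖z‖ := by
    intro t ht
    rw [norm_smul, Real.norm_of_nonneg ht.1]
  have hpos : ∀ t ∈ Icc (0 : ℝ) 1, 0 < 1 - (t * ‖z‖) ^ 2 := by
    intro t ht
    rw [← hnorm t ht]
    exact one_sub_norm_sq_pos (hmem t ht)
  have hγ : ∀ t ∈ Icc (0 : ℝ) 1,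
      HasDerivAt (fun t : ℝ => F (t • z) - F 0) (fderiv ℝ F (t • z) z) t := by
    intro t ht
    have h1 : HasDerivAt (fun t : ℝ => t • z) z t := by
      simpa using (hasDerivAt_id t).smul_const z
    exact ((hF _ (hmem t ht)).hasFDerivAt.comp_hasDerivAt t h1).sub_const _
  have hB : ∀ t ∈ Icc (0 : ℝ) 1, HasDerivAt
      (fun t => C * (t * ‖z‖ / √(1 - (t * ‖z‖) ^ 2)))
      (C * (‖z‖ / (√(1 - (t * ‖z‖) ^ 2)) ^ 3)) t :=
    fun t ht => (hasDerivAt_div_sqrt_one_sub_sq (hpos t ht)).const_mul C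
  have := image_norm_le_of_norm_deriv_right_le_deriv_boundary' (a := (0 : ℝ)) (b := 1)
    (fun t ht => (hγ t ht).continuousAt.continuousWithinAt)
    (fun t ht => (hγ t (Ico_subset_Icc_self ht)).hasDerivWithinAt) (by simp)
    (fun t ht => (hB t ht).continuousAt.continuousWithinAt)
    (fun t ht => (hB t (Ico_subset_Icc_self ht)).hasDerivWithinAt)
    (fun t ht => ?_) (right_mem_Icc.2 zero_le_one)
  · simpa using this
  · have ht' := Ico_subset_Icc_self ht
    have hp := hpos t ht'
    have h1 := hC _ (hmem t ht')
    rw [hnorm t ht'] at h1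
    set s := √(1 - (t * ‖z‖) ^ 2) with hs
    have hs0 : 0 < s := Real.sqrt_pos.2 hp
    have hs2 : s ^ 2 = 1 - (t * ‖z‖) ^ 2 := Real.sq_sqrt hp.le
    have hs1 : s ≤ 1 := Real.sqrt_le_one.2 (by nlinarith [sq_nonneg (t * ‖z‖)])
    rw [← hs2] at h1
    calc ‖fderiv ℝ F (t • z) z‖ ≤ ‖fderiv ℝ F (t • z)‖ * ‖z‖ := ContinuousLinearMap.le_opNorm _ _
      _ ≤ C / s ^ 2 * ‖z‖ := by
        gcongr
        rwa [le_div_iff₀ (by positivity)]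
      -- The passage from artanh to sinh ∘ artanh costs one factor `1 / s ≥ 1`.
      _ ≤ C / s ^ 3 * ‖z‖ := by
        gcongr C / ?_ * ‖z‖
        exact pow_le_pow_of_le_one hs0.le hs1 (by norm_num)
      _ = C * (‖z‖ / s ^ 3) := by ring

/-- A map whose derivative is bounded in the hyperbolic metric of the unit disc is controlled by
`sinhHalfDist`. -/
theorem norm_sub_le_mul_sinhHalfDist {F : ℂ → E} {C : ℝ}
    (hF : ∀ z ∈ unitDisc, DifferentiableAt ℝ F z)
    (hC : ∀ z ∈ unitDisc, ‖fderiv ℝ F z‖ * (1 - ‖z‖ ^ 2) ≤ C) {z w : ℂ} (hz : z ∈ unitDisc)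
    (hw : w ∈ unitDisc) : ‖F z - F w‖ ≤ C * sinhHalfDist z w := by
  have hd : ∀ ζ ∈ unitDisc, DifferentiableAt ℂ (discShift z) ζ :=
    fun ζ hζ => (hasDerivAt_discShift hz hζ).differentiableAt
  -- The shift is a hyperbolic isometry, so the derivative bound survives with the same `C`.
  have := norm_sub_zero_le_of_norm_fderiv_le (F := F ∘ discShift z) (C := C)
    (fun ζ hζ => (hF _ (discShift_mem hz hζ)).comp ζ ((hd ζ hζ).restrictScalars ℝ))
    (fun ζ hζ => ?_) (discShift_mem (neg_mem_unitDisc hz) hw)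
  · rw [← sinhHalfDist_eq_discShift hz hw] at this
    simpa [discShift_discShift_neg hz hw, norm_sub_rev] using this
  · rw [fderiv_comp ζ (hF _ (discShift_mem hz hζ)) ((hd ζ hζ).restrictScalars ℝ)]
    calc _ ≤ ‖fderiv ℝ F (discShift z ζ)‖ * ‖deriv (discShift z) ζ‖ * (1 - ‖ζ‖ ^ 2) := by
          rw [← norm_fderiv_real_eq_norm_deriv (hd ζ hζ)]
          exact mul_le_mul_of_nonneg_right (ContinuousLinearMap.opNorm_comp_le _ _)
            (one_sub_norm_sq_pos hζ).le
      _ = ‖fderiv ℝ F (discShift z ζ)‖ * (1 - ‖discShift z ζ‖ ^ 2) := by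
          rw [mul_assoc, norm_deriv_discShift_mul hz hζ]
      _ ≤ C := hC _ (discShift_mem hz hζ)

end Growth

/-! ### Bloch functions -/

theorem isBlochFunction_of_bounded {f : ℂ → ℂ} (hf : AnalyticOnNhd ℂ f unitDisc) {M : ℝ}
    (hM : ∀ z ∈ unitDisc, ∀ w ∈ unitDisc, z ≠ w →
      √(1 - ‖z‖ ^ 2) * √(1 - ‖w‖ ^ 2) * (‖f z - f w‖ / ‖z - w‖) ≤ M) : IsBlochFunction f := by
  refine ⟨M, fun z hz => ?_⟩
  have h1 := (hasDerivAt_iff_tendsto_slope.1 (hf z hz).differentiableAt.hasDerivAt).norm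
  have h2 : Tendsto (fun w : ℂ => √(1 - ‖z‖ ^ 2) * √(1 - ‖w‖ ^ 2)) (𝓝[≠] z)
      (𝓝 (√(1 - ‖z‖ ^ 2) * √(1 - ‖z‖ ^ 2))) :=
    Tendsto.mono_left (Continuous.tendsto (by fun_prop) z) nhdsWithin_le_nhds
  rw [Real.mul_self_sqrt (one_sub_norm_sq_pos hz).le] at h2
  refine le_of_tendsto (h2.mul h1) ?_
  filter_upwards [self_mem_nhdsWithin, mem_nhdsWithin_of_mem_nhds (isOpen_unitDisc.mem_nhds hz)]
    with w hne hw
  have := hM z hz w hw (Ne.symm hne)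
  rwa [slope_def_field, norm_div, norm_sub_rev (f w), norm_sub_rev w]

theorem sqrt_mul_div_eq_div_sinhHalfDist (z w : ℂ) (x : ℝ) :
    √(1 - ‖z‖ ^ 2) * √(1 - ‖w‖ ^ 2) * (x / ‖z - w‖) = x / sinhHalfDist z w := by
  rw [sinhHalfDist, div_div_eq_mul_div]
  ring

theorem isBlochFunction_iff_bounded {f : ℂ → ℂ} (hf : AnalyticOnNhd ℂ f unitDisc) :
    IsBlochFunction f ↔ ∃ M : ℝ, ∀ z ∈ unitDisc, ∀ w ∈ unitDisc, z ≠ w →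
      √(1 - ‖z‖ ^ 2) * √(1 - ‖w‖ ^ 2) * (‖f z - f w‖ / ‖z - w‖) ≤ M := by
  refine ⟨fun ⟨C, hC⟩ => ⟨C, fun z hz w hw hne => ?_⟩, fun ⟨M, hM⟩ =>
    isBlochFunction_of_bounded hf hM⟩
  rw [sqrt_mul_div_eq_div_sinhHalfDist, div_le_iff₀ (sinhHalfDist_pos hz hw hne)]
  have hd : ∀ z ∈ unitDisc, DifferentiableAt ℂ f z := fun z hz => (hf z hz).differentiableAt
  refine norm_sub_le_mul_sinhHalfDist (fun z hz => (hd z hz).restrictScalars ℝ)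
    (fun z hz => ?_) hz hw
  rw [norm_fderiv_real_eq_norm_deriv (hd z hz), mul_comm]
  exact hC z hz

/-! ### The chordal metric as a Euclidean distance -/

theorem one_add_norm_sq_pos (z : ℂ) : 0 < 1 + ‖z‖ ^ 2 := by positivity

/-- The inverse stereographic projection onto the sphere of diameter `1` through the origin. The
origin is the missing point. -/
noncomputable def stereo (z : ℂ) : WithLp 2 (ℂ × ℝ) :=
  WithLp.toLp 2 ((1 + ‖z‖ ^ 2)⁻¹ • z, (1 + ‖z‖ ^ 2)⁻¹)

theorem stereo_fst (z : ℂ) : (stereo z).fst = (1 + ‖z‖ ^ 2)⁻¹ • z := rfl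

theorem stereo_snd (z : ℂ) : (stereo z).snd = (1 + ‖z‖ ^ 2)⁻¹ := rfl

theorem norm_stereo_sub_stereo_sq (z w : ℂ) :
    ‖stereo z - stereo w‖ ^ 2 = ‖z - w‖ ^ 2 / ((1 + ‖z‖ ^ 2) * (1 + ‖w‖ ^ 2)) := by
  have hz := one_add_norm_sq_pos z
  have hw := one_add_norm_sq_pos w
  rw [WithLp.prod_norm_sq_eq_of_L2]
  simp only [stereo_fst, stereo_snd, WithLp.sub_fst, WithLp.sub_snd, Real.norm_eq_abs, sq_abs]
  simp only [Complex.sq_norm, Complex.normSq_apply, Complex.sub_re, Complex.sub_im,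
    Complex.smul_re, Complex.smul_im, smul_eq_mul] at *
  field_simp
  ring

theorem norm_stereo_sub_stereo (z w : ℂ) :
    ‖stereo z - stereo w‖ = ‖z - w‖ / (√(1 + ‖z‖ ^ 2) * √(1 + ‖w‖ ^ 2)) := by
  rw [← Real.sqrt_mul (by positivity), ← Real.sqrt_sq (norm_nonneg (stereo z - stereo w)),
    norm_stereo_sub_stereo_sq, Real.sqrt_div (by positivity), Real.sqrt_sq (by positivity)]

theorem norm_stereo_sq (z : ℂ) : ‖stereo z‖ ^ 2 = 1 / (1 + ‖z‖ ^ 2) := by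
  have hz := one_add_norm_sq_pos z
  rw [WithLp.prod_norm_sq_eq_of_L2]
  simp only [stereo_fst, stereo_snd, Real.norm_eq_abs, norm_smul, mul_pow, sq_abs]
  field_simp
  ring

theorem norm_stereo (z : ℂ) : ‖stereo z‖ = 1 / √(1 + ‖z‖ ^ 2) := by
  rw [← Real.sqrt_sq (norm_nonneg (stereo z)), norm_stereo_sq, Real.sqrt_div zero_le_one,
    Real.sqrt_one]

/-- Inversion acts on the sphere as a rotation; this lets large values be exchanged for small ones.
-/
theorem norm_stereo_inv_sub {z w : ℂ} (hz : z ≠ 0) (hw : w ≠ 0) :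
    ‖stereo z⁻¹ - stereo w⁻¹‖ = ‖stereo z - stereo w‖ := by
  rw [← sq_eq_sq₀ (norm_nonneg _) (norm_nonneg _), norm_stereo_sub_stereo_sq,
    norm_stereo_sub_stereo_sq, inv_sub_inv hz hw, norm_div, norm_mul, norm_inv, norm_inv,
    norm_sub_rev w z]
  have := norm_pos_iff.2 hz
  have := norm_pos_iff.2 hw
  field_simp
  ring

theorem differentiable_stereo : Differentiable ℝ stereo := by
  have h1 : Differentiable ℝ fun z : ℂ => (1 + ‖z‖ ^ 2)⁻¹ :=
    ((differentiable_id.norm_sq ℂ).const_add 1).inv fun z => (one_add_norm_sq_pos z).ne'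
  exact (WithLp.prodContinuousLinearEquiv 2 ℝ ℂ ℝ).symm.differentiable.comp
    ((h1.smul differentiable_id).prodMk h1)

/-- Any constant above the limit of the chordal quotient at `z` is a local Lipschitz constant there.
-/
theorem norm_fderiv_stereo_le (z : ℂ) : ‖fderiv ℝ stereo z‖ ≤ 1 / (1 + ‖z‖ ^ 2) := by
  refine le_of_forall_gt_imp_ge_of_dense fun C hC => ?_
  have hC0 : 0 ≤ C := le_trans (by positivity) hC.le
  refine (differentiable_stereo z).hasFDerivAt.le_of_lip' hC0 ?_
  have h : Tendsto (fun w : ℂ => 1 / (√(1 + ‖w‖ ^ 2) * √(1 + ‖z‖ ^ 2))) (𝓝 z)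
      (𝓝 (1 / (√(1 + ‖z‖ ^ 2) * √(1 + ‖z‖ ^ 2)))) := by
    refine Tendsto.div tendsto_const_nhds (Continuous.tendsto (by fun_prop) z) ?_
    positivity
  rw [Real.mul_self_sqrt (by positivity)] at h
  filter_upwards [h.eventually (gt_mem_nhds hC)] with w hw
  rw [norm_stereo_sub_stereo, div_eq_mul_one_div, mul_comm]
  gcongr

/-- The embedding of the Riemann sphere that extends `stereo`. -/
noncomputable def sphereEmbedding : OnePoint ℂ → WithLp 2 (ℂ × ℝ)
  | some z => stereo z
  | none => 0

theorem sphereEmbedding_coe (z : ℂ) : sphereEmbedding (z : OnePoint ℂ) = stereo z := rfl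

theorem chordalDist_eq_norm_sub (p q : OnePoint ℂ) :
    chordalDist p q = ‖sphereEmbedding p - sphereEmbedding q‖ := by
  match p, q with
  | some z, some w => exact (norm_stereo_sub_stereo z w).symm
  | some z, none => simp [chordalDist, sphereEmbedding, norm_stereo]
  | none, some w => simp [chordalDist, sphereEmbedding, norm_stereo]
  | none, none => simp [chordalDist, sphereEmbedding]

/-- The equation of the sphere makes the range visibly closed. Its only point of height `0` is the
origin, the image of ∞. -/
theorem range_sphereEmbedding :
    range sphereEmbedding = {p | ‖p.fst‖ ^ 2 + p.snd ^ 2 = p.snd} := by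
  ext p
  constructor
  · rintro ⟨q, rfl⟩
    match q with
    | some z =>
      have hz := one_add_norm_sq_pos z
      simp only [sphereEmbedding, stereo_fst, stereo_snd, mem_ofPred_eq, norm_smul, norm_inv,
        Real.norm_of_nonneg hz.le]
      field_simp
      ring
    | none => simp [sphereEmbedding]
  · intro h
    simp only [mem_ofPred_eq] at h
    by_cases h0 : p.snd = 0
    · refine ⟨none, ?_⟩
      have h1 : p.fst = 0 := by simpa [h0] using h
      exact (WithLp.ofLp_injective 2 (Prod.ext h1 h0)).symm
    · refine ⟨some ((p.snd)⁻¹ • p.fst), ?_⟩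
      have h1 : (1 + ‖(p.snd)⁻¹ • p.fst‖ ^ 2)⁻¹ = p.snd := by
        rw [norm_smul, mul_pow, norm_inv, Real.norm_eq_abs, inv_pow, sq_abs, inv_eq_iff_eq_inv]
        field_simp
        linarith
      refine WithLp.ofLp_injective 2 (Prod.ext ?_ ?_)
      · simp only [sphereEmbedding, stereo, h1]
        rw [smul_inv_smul₀ h0]
        rfl
      · simp only [sphereEmbedding, stereo, h1]
        rfl

theorem isCompact_range_sphereEmbedding : IsCompact (range sphereEmbedding) := by
  refine Metric.isCompact_of_isClosed_isBounded ?_ ?_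
  · rw [range_sphereEmbedding]
    refine isClosed_eq ?_ ?_ <;> fun_prop
  · refine (isBounded_closedBall (x := 0) (r := 1)).subset ?_
    rintro _ ⟨q, rfl⟩
    rw [mem_closedBall_zero_iff]
    match q with
    | some z =>
      rw [sphereEmbedding, norm_stereo, div_le_one (by positivity), Real.one_le_sqrt]
      linarith [sq_nonneg ‖z‖]
    | none => simp [sphereEmbedding]

/-! ### Normality and equicontinuity -/

theorem TendstoChordallyOn.tendstoUniformlyOn {u : ℕ → ℂ → OnePoint ℂ} {g : ℂ → OnePoint ℂ}
    {U K : Set ℂ} (h : TendstoChordallyOn u g U) (hKU : K ⊆ U) (hK : IsCompact K) :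
    TendstoUniformlyOn (fun n z => sphereEmbedding (u n z)) (fun z => sphereEmbedding (g z))
      atTop K := by
  rw [Metric.tendstoUniformlyOn_iff]
  intro ε hε
  filter_upwards [h K hKU hK ε hε] with n hn z hz
  rw [dist_comm, dist_eq_norm, ← chordalDist_eq_norm_sub]
  exact hn z hz

/-- A family of sphere-valued functions on an open set with a common chordal modulus of continuity
that tends to `0` on the diagonal is normal. -/
theorem isNormalFamilyOn_of_chordalDist_le {F : Set (ℂ → OnePoint ℂ)} {U : Set ℂ} (hU : IsOpen U)
    {δ : ℂ → ℂ → ℝ} (hδ : ∀ z ∈ U, Tendsto (δ z) (𝓝[U] z) (𝓝 0))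
    (hF : ∀ h ∈ F, ∀ z ∈ U, ∀ w ∈ U, chordalDist (h z) (h w) ≤ δ z w) : IsNormalFamilyOn F U := by
  intro u hu
  let T : Set (U → WithLp 2 (ℂ × ℝ)) :=
    {v | (∀ z, v z ∈ range sphereEmbedding) ∧ ∀ z w, ‖v z - v w‖ ≤ δ z w}
  have hδ' : ∀ z : U, Tendsto (fun w : U => δ z w) (𝓝 z) (𝓝 0) := by
    intro z
    have := hδ z z.2
    rwa [← map_nhds_subtype_val, tendsto_map'_iff] at this
  have hTcont : ∀ v ∈ T, Continuous v := by
    intro v hv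
    refine continuous_iff_continuousAt.2 fun z => ?_
    rw [ContinuousAt, tendsto_iff_norm_sub_tendsto_zero]
    refine squeeze_zero (fun _ => norm_nonneg _) (fun w => ?_) (hδ' z)
    rw [norm_sub_rev]
    exact hv.2 z w
  -- Tychonoff: `T` is pointwise closed in a product of copies of the compact sphere.
  have hTcomp : IsCompact T := by
    refine (isCompact_univ_pi fun _ : U => isCompact_range_sphereEmbedding).of_isClosed_subset
      ?_ fun v hv z _ => hv.1 z
    have hcl := isCompact_range_sphereEmbedding.isClosed
    simp only [T, ofPred_and, ofPred_forall]
    refine (isClosed_iInter fun z => hcl.preimage (continuous_apply z)).inter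
      (isClosed_iInter fun z => isClosed_iInter fun w => isClosed_le ?_ continuous_const)
    fun_prop
  let S : Set C(U, WithLp 2 (ℂ × ℝ)) := {v | ⇑v ∈ T}
  have hS : IsCompact S := by
    refine ArzelaAscoli.isCompact_of_equicontinuous S ?_ ?_
    · convert hTcomp
      ext v
      exact ⟨by rintro ⟨v, hv, rfl⟩; exact hv, fun hv => ⟨⟨v, hTcont v hv⟩, hv, rfl⟩⟩
    · intro z
      refine Metric.equicontinuousAt_of_continuity_modulus (fun w : U => δ z w) (hδ' z) _ ?_
      refine Eventually.of_forall fun w v => ?_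
      rw [dist_eq_norm]
      exact v.2.2 z w
  have hu' : ∀ n, (fun z : U => sphereEmbedding (u n z)) ∈ T := by
    refine fun n => ⟨fun z => mem_range_self _, fun z w => ?_⟩
    rw [← chordalDist_eq_norm_sub]
    exact hF _ (hu n) z z.2 w w.2
  have : LocallyCompactSpace U := hU.locallyCompactSpace
  obtain ⟨v, hv, k, hk, hlim⟩ := hS.isSeqCompact
    (x := fun n => (⟨_, hTcont _ (hu' n)⟩ : C(U, WithLp 2 (ℂ × ℝ)))) hu'
  choose g hg using hv.1
  classical
  -- The value off `U` is immaterial, since only compact subsets of `U` are tested.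
  refine ⟨k, fun z => if hz : z ∈ U then g ⟨z, hz⟩ else OnePoint.infty, hk, ?_⟩
  intro K hKU hK ε hε
  have hK' : IsCompact ((↑) ⁻¹' K : Set U) :=
    Topology.IsInducing.subtypeVal.isCompact_preimage' hK (by simpa using hKU)
  have := (Metric.tendstoUniformlyOn_iff.1
    (ContinuousMap.tendsto_iff_forall_isCompact_tendstoUniformlyOn.1 hlim _ hK')) ε hε
  filter_upwards [this] with n hn z hz
  have h1 := hn ⟨z, hKU hz⟩ hz
  rw [dist_comm, dist_eq_norm] at h1
  rw [chordalDist_eq_norm_sub, dif_pos (hKU hz), hg]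
  exact h1

/-- The members of a normal family of continuous functions are equicontinuous at each point. -/
theorem IsNormalFamilyOn.exists_forall_chordalDist_lt {F : Set (ℂ → OnePoint ℂ)} {U : Set ℂ}
    (hF : IsNormalFamilyOn F U) (hU : IsOpen U)
    (hc : ∀ h ∈ F, ContinuousOn (fun z => sphereEmbedding (h z)) U) {c : ℂ} (hcU : c ∈ U)
    {ε : ℝ} (hε : 0 < ε) :
    ∃ r > 0, ball c r ⊆ U ∧ ∀ h ∈ F, ∀ z ∈ ball c r,
      ‖sphereEmbedding (h z) - sphereEmbedding (h c)‖ < ε := by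
  obtain ⟨R, hR, hRU⟩ := nhds_basis_closedBall.mem_iff.1 (hU.mem_nhds hcU)
  by_contra! hcon
  have hr : ∀ n : ℕ, 0 < R / (n + 1) := fun n => by positivity
  have hrR : ∀ n : ℕ, R / (n + 1) ≤ R := fun n =>
    div_le_self hR.le (by linarith [n.cast_nonneg (α := ℝ)])
  have hsub : ∀ n : ℕ, ball c (R / (n + 1)) ⊆ closedBall c R := fun n =>
    (ball_subset_ball (hrR n)).trans ball_subset_closedBall
  -- Failure of equicontinuity yields members `u n` and points `z n → c` with a jump of at least
  -- `ε`. Along a convergent subsequence the values at `z (k n)` and at `c` have the same limit, a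
  -- contradiction.
  choose u hu z hz hlt using fun n => hcon _ (hr n) ((hsub n).trans hRU)
  obtain ⟨k, g, hk, hg⟩ := hF u hu
  have hunif := hg.tendstoUniformlyOn hRU (isCompact_closedBall c R)
  have hgc : ContinuousOn (fun z => sphereEmbedding (g z)) (closedBall c R) :=
    hunif.continuousOn (Frequently.of_forall fun n => (hc _ (hu (k n))).mono hRU)
  have hgc' : ContinuousAt (fun z => sphereEmbedding (g z)) c :=
    hgc.continuousAt (closedBall_mem_nhds c hR)
  have hzlim : Tendsto z atTop (𝓝 c) := by
    rw [tendsto_iff_dist_tendsto_zero]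
    refine squeeze_zero (fun _ => dist_nonneg) (fun n => (hz n).le) ?_
    simpa [div_eq_mul_inv] using tendsto_one_div_add_atTop_nhds_zero_nat.const_mul R
  have hloc : ∀ s ∈ uniformity (WithLp 2 (ℂ × ℝ)), ∃ t ∈ 𝓝 c, ∀ᶠ n in atTop, ∀ y ∈ t,
      (sphereEmbedding (g y), sphereEmbedding (u (k n) y)) ∈ s := fun s hs =>
    ⟨_, closedBall_mem_nhds c hR, hunif s hs⟩
  have h1 := tendsto_comp_of_locally_uniform_limit hgc' (hzlim.comp hk.tendsto_atTop) hloc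
  have h2 := tendsto_comp_of_locally_uniform_limit hgc'
    (tendsto_const_nhds (f := atTop (α := ℕ))) hloc
  have h3 := (h1.sub h2).norm
  rw [sub_self, norm_zero] at h3
  exact absurd (ge_of_tendsto' h3 fun n => hlt (k n)) (not_le.2 hε)

/-! ### Spherical derivative estimates -/

/-- A bound for the derivative at the centre of a disc on which the function stays chordally close
to its central value, when this value has norm at most `1`. -/
theorem norm_deriv_le_of_stereo_close_of_norm_le_one {g : ℂ → ℂ} {c : ℂ} {r : ℝ} (hr : 0 < r)
    (hg : DifferentiableOn ℂ g (ball c r))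
    (hclose : ∀ z ∈ ball c r, ‖stereo (g z) - stereo (g c)‖ < 1 / 4) (h1 : ‖g c‖ ≤ 1) :
    ‖deriv g c‖ ≤ 4 / r := by
  have hlow : 1 / 2 ≤ ‖stereo (g c)‖ ^ 2 := by
    rw [norm_stereo_sq]
    gcongr
    nlinarith [norm_nonneg (g c)]
  have hlow' : 2 / 3 ≤ ‖stereo (g c)‖ := by
    by_contra! h
    nlinarith [norm_nonneg (stereo (g c))]
  refine Complex.norm_deriv_le_div_of_mapsTo_ball hg (fun z hz => ?_) hr
  -- `‖stereo _‖` is the chordal distance to ∞, and 2/3 - 1/4 = 5/12. This keeps |g| ≤ 3, so `g`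
  -- stays within 3 + 1 = 4 of `g c`.
  have h2 : 5 / 12 ≤ ‖stereo (g z)‖ := by
    have := norm_sub_norm_le (stereo (g c)) (stereo (g z))
    rw [norm_sub_rev] at this
    linarith [hclose z hz]
  have h3 : (5 / 12) ^ 2 ≤ ‖stereo (g z)‖ ^ 2 := by gcongr
  rw [norm_stereo_sq, le_div_iff₀ (one_add_norm_sq_pos _)] at h3
  have h4 : ‖g z‖ ≤ 3 := by
    by_contra! h
    nlinarith
  rw [mem_closedBall, dist_eq_norm]
  linarith [norm_sub_le (g z) (g c)]

/-- If |g c| ≥ 1, the previous bound is applied to 1/g, whose derivative at `c` has modulus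
|g'|/|g|² ≥ |g'|/(1 + |g|²). -/
theorem norm_deriv_div_le_of_stereo_close {g : ℂ → ℂ} {c : ℂ} {r : ℝ} (hr : 0 < r)
    (hg : DifferentiableOn ℂ g (ball c r))
    (hclose : ∀ z ∈ ball c r, ‖stereo (g z) - stereo (g c)‖ < 1 / 4) :
    ‖deriv g c‖ / (1 + ‖g c‖ ^ 2) ≤ 4 / r := by
  have hc : c ∈ ball c r := mem_ball_self hr
  rcases le_total ‖g c‖ 1 with h1 | h1
  · refine (div_le_self (norm_nonneg _) ?_).trans
      (norm_deriv_le_of_stereo_close_of_norm_le_one hr hg hclose h1)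
    linarith [sq_nonneg ‖g c‖]
  -- The squared chordal distance from `g c` to `0` is at least 1/2, beyond the allowed 1/16.
  · have hne : ∀ z ∈ ball c r, g z ≠ 0 := by
      intro z hz h0
      have h2 := hclose z hz
      have h3 : ‖stereo (g z) - stereo (g c)‖ ^ 2 < (1 / 4) ^ 2 := by gcongr
      rw [norm_stereo_sub_stereo_sq, h0, div_lt_iff₀ (by positivity)] at h3
      simp only [zero_sub, norm_neg, norm_zero] at h3
      nlinarith
    have hgc := hg.differentiableAt (isOpen_ball.mem_nhds hc)
    have h2 := norm_deriv_le_of_stereo_close_of_norm_le_one (g := fun z => (g z)⁻¹) hr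
      (hg.inv hne) (fun z hz => by
        rw [norm_stereo_inv_sub (hne z hz) (hne c hc)]
        exact hclose z hz) (by rw [norm_inv]; exact inv_le_one_of_one_le₀ h1)
    refine le_trans ?_ h2
    rw [deriv_fun_inv'' hgc (hne c hc), norm_div, norm_neg, norm_pow]
    gcongr
    linarith

/-! ### Normal functions -/

theorem differentiableOn_comp_discAutomorphism {f φ : ℂ → ℂ} (hf : AnalyticOnNhd ℂ f unitDisc)
    (hφ : IsDiscAutomorphism φ) : DifferentiableOn ℂ (fun z => f (φ z)) unitDisc :=
  hf.differentiableOn.comp hφ.1 hφ.2.mapsTo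

/-- Equicontinuity at `0` supplies one radius for every automorphism; the chain rule for `f ∘
discShift z` at `0` transfers the estimate to `z`. -/
theorem IsNormalFunction.exists_norm_deriv_div_le {f : ℂ → ℂ} (hf : AnalyticOnNhd ℂ f unitDisc)
    (hn : IsNormalFunction f) :
    ∃ C : ℝ, ∀ z ∈ unitDisc, ‖deriv f z‖ / (1 + ‖f z‖ ^ 2) * (1 - ‖z‖ ^ 2) ≤ C := by
  have hcont : ∀ h ∈ {h | ∃ φ : ℂ → ℂ, IsDiscAutomorphism φ ∧
      h = fun z => (f (φ z) : OnePoint ℂ)},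
      ContinuousOn (fun z => sphereEmbedding (h z)) unitDisc := by
    rintro _ ⟨φ, hφ, rfl⟩
    simp only [sphereEmbedding_coe]
    exact differentiable_stereo.continuous.comp_continuousOn
      (differentiableOn_comp_discAutomorphism hf hφ).continuousOn
  obtain ⟨r, hr, hsub, hclose⟩ := IsNormalFamilyOn.exists_forall_chordalDist_lt hn
    isOpen_unitDisc hcont zero_mem_unitDisc (ε := 1 / 4) (by norm_num)
  refine ⟨4 / r, fun z hz => ?_⟩
  have hφ := isDiscAutomorphism_discShift hz
  have hclose' := hclose _ ⟨discShift z, hφ, rfl⟩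
  simp only [sphereEmbedding_coe] at hclose'
  have h1 := norm_deriv_div_le_of_stereo_close hr
    ((differentiableOn_comp_discAutomorphism hf hφ).mono hsub) hclose'
  have hd : HasDerivAt (fun ζ => f (discShift z ζ)) (deriv f z * deriv (discShift z) 0) 0 := by
    refine HasDerivAt.comp (0 : ℂ) (h₂ := f) ?_
      (hasDerivAt_discShift hz zero_mem_unitDisc).differentiableAt.hasDerivAt
    rw [discShift_zero]
    exact (hf z hz).differentiableAt.hasDerivAt
  have h2 := norm_deriv_discShift_mul hz zero_mem_unitDisc
  simp only [norm_zero, discShift_zero] at h2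
  rw [hd.deriv, discShift_zero, norm_mul] at h1
  rw [← h2]
  convert h1 using 1
  ring

theorem norm_stereo_sub_le_of_norm_deriv_div_le {f : ℂ → ℂ} (hf : AnalyticOnNhd ℂ f unitDisc)
    {C : ℝ} (hC : ∀ z ∈ unitDisc, ‖deriv f z‖ / (1 + ‖f z‖ ^ 2) * (1 - ‖z‖ ^ 2) ≤ C) {z w : ℂ}
    (hz : z ∈ unitDisc) (hw : w ∈ unitDisc) :
    ‖stereo (f z) - stereo (f w)‖ ≤ C * sinhHalfDist z w := by
  have hd : ∀ z ∈ unitDisc, DifferentiableAt ℂ f z := fun z hz => (hf z hz).differentiableAt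
  refine norm_sub_le_mul_sinhHalfDist (F := fun z => stereo (f z))
    (fun z hz => (differentiable_stereo _).comp z ((hd z hz).restrictScalars ℝ))
    (fun z hz => le_trans ?_ (hC z hz)) hz hw
  refine mul_le_mul_of_nonneg_right ?_ (one_sub_norm_sq_pos hz).le
  rw [fderiv_fun_comp z (differentiable_stereo _) ((hd z hz).restrictScalars ℝ)]
  refine (ContinuousLinearMap.opNorm_comp_le _ _).trans ?_
  rw [norm_fderiv_real_eq_norm_deriv (hd z hz), div_eq_mul_one_div, mul_comm]
  gcongr
  exact norm_fderiv_stereo_le _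

/-- By Schwarz–Pick, `M * sinhHalfDist` is a modulus of continuity common to all `f ∘ φ`. -/
theorem isNormalFunction_of_norm_stereo_sub_le {f : ℂ → ℂ} {M : ℝ} (hM0 : 0 ≤ M)
    (hM : ∀ z ∈ unitDisc, ∀ w ∈ unitDisc,
      ‖stereo (f z) - stereo (f w)‖ ≤ M * sinhHalfDist z w) : IsNormalFunction f := by
  refine isNormalFamilyOn_of_chordalDist_le isOpen_unitDisc
    (δ := fun z w => M * sinhHalfDist z w) (fun z hz => ?_) ?_
  · have h : ContinuousAt (fun w => M * sinhHalfDist z w) z := by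
      unfold sinhHalfDist
      have := Real.sqrt_pos.2 (one_sub_norm_sq_pos hz)
      exact continuousAt_const.mul (ContinuousAt.div (by fun_prop) (by fun_prop) (by positivity))
    have h0 : M * sinhHalfDist z z = 0 := by simp [sinhHalfDist]
    rw [ContinuousAt, h0] at h
    exact h.mono_left nhdsWithin_le_nhds
  · rintro _ ⟨φ, hφ, rfl⟩ z hz w hw
    rw [chordalDist_eq_norm_sub]
    exact (hM _ (hφ.2.mapsTo hz) _ (hφ.2.mapsTo hw)).trans
      (mul_le_mul_of_nonneg_left (sinhHalfDist_map_le hφ.1 hφ.2.mapsTo hz hw) hM0)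

theorem chordal_quotient_eq_div_sinhHalfDist (f : ℂ → ℂ) (z w : ℂ) :
    (√(1 - ‖z‖ ^ 2) * √(1 - ‖w‖ ^ 2)) / (√(1 + ‖f z‖ ^ 2) * √(1 + ‖f w‖ ^ 2)) *
      (‖f z - f w‖ / ‖z - w‖) = ‖stereo (f z) - stereo (f w)‖ / sinhHalfDist z w := by
  rw [norm_stereo_sub_stereo, ← sqrt_mul_div_eq_div_sinhHalfDist]
  ring

theorem isNormalFunction_iff_bounded {f : ℂ → ℂ} (hf : AnalyticOnNhd ℂ f unitDisc) :
    IsNormalFunction f ↔ ∃ M : ℝ, ∀ z ∈ unitDisc, ∀ w ∈ unitDisc, z ≠ w →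
      (√(1 - ‖z‖ ^ 2) * √(1 - ‖w‖ ^ 2)) / (√(1 + ‖f z‖ ^ 2) * √(1 + ‖f w‖ ^ 2)) *
        (‖f z - f w‖ / ‖z - w‖) ≤ M := by
  simp only [chordal_quotient_eq_div_sinhHalfDist]
  constructor
  · intro hn
    obtain ⟨C, hC⟩ := hn.exists_norm_deriv_div_le hf
    refine ⟨C, fun z hz w hw hne => ?_⟩
    rw [div_le_iff₀ (sinhHalfDist_pos hz hw hne)]
    exact norm_stereo_sub_le_of_norm_deriv_div_le hf hC hz hw
  · rintro ⟨M, hM⟩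
    -- Taking `max M 0` gives a nonnegative constant without exhibiting two distinct points.
    refine isNormalFunction_of_norm_stereo_sub_le (le_max_right M 0) fun z hz w hw => ?_
    rcases eq_or_ne z w with rfl | hne
    · simp [sinhHalfDist]
    · rw [← div_le_iff₀ (sinhHalfDist_pos hz hw hne)]
      exact (hM z hz w hw hne).trans (le_max_left M 0)

theorem mainTheorem7 (f : ℂ → ℂ) (hf : AnalyticOnNhd ℂ f unitDisc) :
    (IsBlochFunction f ↔
      ∃ M : ℝ, ∀ z ∈ unitDisc, ∀ w ∈ unitDisc, z ≠ w →
        √(1 - ‖z‖ ^ 2) * √(1 - ‖w‖ ^ 2) * (‖f z - f w‖ / ‖z - w‖) ≤ M) ∧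
    (IsNormalFunction f ↔
      ∃ M : ℝ, ∀ z ∈ unitDisc, ∀ w ∈ unitDisc, z ≠ w →
        (√(1 - ‖z‖ ^ 2) * √(1 - ‖w‖ ^ 2)) / (√(1 + ‖f z‖ ^ 2) * √(1 + ‖f w‖ ^ 2)) *
          (‖f z - f w‖ / ‖z - w‖) ≤ M) :=
  ⟨isBlochFunction_iff_bounded hf, isNormalFunction_iff_bounded hf⟩
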